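/- **Setting.** Consider a project with finite nonempty state space $N$, $n=|N|$, discount factor $0<\beta<1$, transition probabilities $\mathbf P=(p_{ij})$ and rewards $R_i$ when active (engaged); when passive (rested) the state is frozen and the reward is $0$. Startup costs $c_i$ are incurred when a previously rested project is engaged in state $i$, and shutdown costs $d_i$ when a previously engaged project is rested in state $i$, with $c_i+d_i\ge 0$ for all $i$. The restless reformulation has augmented states $(a^-,i)\in\{0,1\}\times N$, where $a^-$ is the previous action; engaging yields $R_i-(1-a^-)c_i$ and leads to $(1,j)$ with probability $p_{ij}$, resting yields $-a^-d_i$ and leads to $(0,i)$. For a policy $\pi$ let $f^\pi_x$ and $g^\pi_x$ be the expected total discounted reward and number of active periods from augmented state $x$. The marginal productivity index (MPI) is the function $\nu^*$ on $\{0,1\}\times N$ such that, for every wage $\nu\in\mathbb R$, engaging is the only optimal action in state $x$ for the problem $\max_\pi f^\pi_x-\nu g^\pi_x$ if and only if $\nu^*_x>\nu$; $\nu^*_{(0,i)}$ is the switching MPI. Let $\tilde{\mathbf c}=\mathbf c+\mathbf d$ and $\tilde{\mathbf R}=\mathbf R+(\mathbf I-\beta\mathbf P)\mathbf d$ be the normalized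 startup costs and rewards (so $\tilde{\mathbf c}=\mathbf c$, $\tilde{\mathbf R}=\mathbf R$ if $\mathbf d=\mathbf 0$). The AT (Asawa–Teneketzis) switching index is $$\nu^{\mathrm{AT}}_{(0,i)}=\max_{\tau>0}\frac{\mathsf E_i^\tau\big[-\tilde c_i+\sum_{t=0}^{\tau-1}\tilde R_{X(t)}\beta^t\big]}{\mathsf E_i^\tau\big[\sum_{t=0}^{\tau-1}\beta^t\big]},$$ the maximum being over stopping times $\tau$ of the state process $X(t)$ of the continuously engaged project. For $S\subseteq N$, consider the project without switching costs and with rewards $\tilde{\mathbf R}$. Let $w^S_i$ (resp. $r^S_i$) be the difference in expected total discounted number of active periods (resp. reward), starting at $i$, between engaging and resting in the initial period, when in both cases the project is engaged thereafter exactly when its state lies in $S$; let $\nu^S_i=r^S_i/w^S_i$. **Algorithm $\mathrm{AG}^1$** (continuation index). Set $S_1^0=\emptyset$; for $k=1,\dots,n$ pick $i_1^k\in\arg\max\{\nu^{S_1^{k-1}}_i: i\in N\setminus S_1^{k-1}\}$ and set $\nu^*_{i_1^k}=\nu^{S_1^{k-1}}_{i_1^k}$, $S_1^k=S_1^{k-1}\cup\{i_1^k\}$.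 The output consists of $i_1^k$, $\nu^*_{i_1^k}$ and $w^{(k)}_j=w^{S_1^k}_j$, $\nu^{(k)}_j=\nu^{S_1^k}_j$ for $j\in S_1^k$, $1\le k\le n$. **Algorithm $\mathrm{AG}^0$** (switching index), fed this output. Set $k_0=0$, $S_0=\emptyset$. For $k_1=1,\dots,n$: set $\nu^{(0,k_1)}_{(0,j)}=\nu^{(k_1)}_j-(1-\beta)\tilde c_j/w^{(k_1)}_j$ for $j\in S_1^{k_1}\setminus S_0$; then, as long as $k_0<k_1$, pick $j\in\arg\max\{\nu^{(0,k_1)}_{(0,j)}: j\in S_1^{k_1}\setminus S_0\}$, and, if $k_1=n$ or $\nu^*_{i_1^{k_1+1}}<\nu^{(0,k_1)}_{(0,j)}$, output the state $i_0^{k_0+1}=j$ with the value $\nu^{(0,k_1)}_{(0,j)}$, add $j$ to $S_0$ and increase $k_0$ by one; otherwise proceed to the next $k_1$. **Theorem.** However ties are broken in the two algorithms, $\mathrm{AG}^0$ outputs every state of $N$ exactly once, with nonincreasing values. The MPI $\nu^*$ exists, and the value output with each state $i$ is the switching MPI $\nu^*_{(0,i)}$, which equals the AT switching index $\nu^{\mathrm{AT}}_{(0,i)}$.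 -/

import Mathlib

/-! ## Binary-action discounted Markov decision processes -/

/-- The data of a binary-action discounted Markov decision process with state space `X`.
The action `true` is "active" (engage, `1`) and `false` is "passive" (rest, `0`).
It is used below only for the two processes `Project.base` and `Project.restless`. -/
structure Bandit (X : Type*) where
  /-- discount factor -/
  discount : ℝ
  /-- `trans a x y` is the one-period transition probability from `x` to `y` under action `a` -/
  trans : Bool → X → X → ℝ
  /-- `reward a x` is the one-period reward for action `a` in state `x` -/
  reward : Bool → X → ℝ

/-- An admissible (nonanticipative, possibly randomized) policy: given the past states and
actions, latest first, and the current state, the probability of taking the active action. -/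
def Policy (X : Type*) : Type _ := List (X × Bool) → X → unitInterval

namespace Policy

variable {X : Type*}

/-- The probability with which `π` takes action `a` in state `x` after the history `h`. -/
noncomputable def prob (π : Policy X) (h : List (X × Bool)) (x : X) (a : Bool) : ℝ :=
  if a = true then (π h x : ℝ) else 1 - (π h x : ℝ)

/-- The sure decision to take action `a`. -/
def sure (a : Bool) : unitInterval := if a = true then 1 else 0

/-- The `S`-active policy: the stationary deterministic policy that is active exactly on `S`. -/
def active [DecidableEq X] (S : Finset X) : Policy X := fun _ x => sure (decide (x ∈ S))

/-- The policy `⟨a, S⟩`: action `a` in the initial period, the `S`-active policy thereafter. -/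
def firstThen [DecidableEq X] (a : Bool) (S : Finset X) : Policy X
  | [], _ => sure a
  | y :: h, x => active S (y :: h) x

end Policy

namespace Bandit

variable {X : Type*} [Fintype X]

/-- `B.stage π q t h x` is the conditional expectation of `q (a(t)) (X(t))` under the policy `π`
when the history before the present period is `h` and the process is now, `t` periods earlier,
in state `x`.  It is computed by conditioning on the present action and the next state.
In particular `B.stage π q t [] x = E_x^π[q (a(t)) (X(t))]`. -/
noncomputable def stage (B : Bandit X) (π : Policy X) (q : Bool → X → ℝ) :
    ℕ → List (X × Bool) → X → ℝ
  | 0, h, x => ∑ a : Bool, π.prob h x a * q a x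
  | t + 1, h, x =>
      ∑ a : Bool, π.prob h x a * ∑ y : X, B.trans a x y * stage B π q t ((x, a) :: h) y

/-- The expected total discounted value `E_x^π[∑ₜ q (a(t)) (X(t)) βᵗ]`. -/
noncomputable def total (B : Bandit X) (π : Policy X) (q : Bool → X → ℝ) (x : X) : ℝ :=
  ∑' t : ℕ, B.discount ^ t * B.stage π q t [] x

/-- The reward measure `f^π_x`. -/
noncomputable def rewardMeasure (B : Bandit X) (π : Policy X) (x : X) : ℝ :=
  B.total π B.reward x

/-- The work measure `g^π_x = E_x^π[∑ₜ a(t) βᵗ]`. -/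
noncomputable def workMeasure (B : Bandit X) (π : Policy X) (x : X) : ℝ :=
  B.total π (fun a _ => if a = true then 1 else 0) x

/-- The objective `f^π_x - ν g^π_x` of the `ν`-wage problem. -/
noncomputable def netValue (B : Bandit X) (ν : ℝ) (π : Policy X) (x : X) : ℝ :=
  B.rewardMeasure π x - ν * B.workMeasure π x

/-- `π` solves the `ν`-wage problem for the initial state `x`. -/
def IsOptimalFrom (B : Bandit X) (ν : ℝ) (π : Policy X) (x : X) : Prop :=
  ∀ π' : Policy X, B.netValue ν π' x ≤ B.netValue ν π x

/-- Action `a` is optimal in state `x` for the `ν`-wage problem: some policy that is optimal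
from `x` starts with `a`. -/
def IsOptimalAction (B : Bandit X) (ν : ℝ) (a : Bool) (x : X) : Prop :=
  ∃ π : Policy X, B.IsOptimalFrom ν π x ∧ π [] x = Policy.sure a

/-- The minimal optimal active set for the wage `ν`: the states in which engaging is the only
optimal action. -/
def minimalActiveSet (B : Bandit X) (ν : ℝ) : Set X :=
  {x | B.IsOptimalAction ν true x ∧ ¬ B.IsOptimalAction ν false x}

/-- The process is indexable and `idx` is its marginal productivity index (MPI): at every wage
`ν`, the minimal optimal active set consists of the states whose index exceeds `ν`.
(Such an `idx` is unique.) -/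
def IsMPI (B : Bandit X) (idx : X → ℝ) : Prop :=
  ∀ ν : ℝ, B.minimalActiveSet ν = {x | ν < idx x}

variable [DecidableEq X]

/-- The marginal work measure `w^S_x = g^⟨1,S⟩_x - g^⟨0,S⟩_x`. -/
noncomputable def marginalWork (B : Bandit X) (S : Finset X) (x : X) : ℝ :=
  B.workMeasure (Policy.firstThen true S) x - B.workMeasure (Policy.firstThen false S) x

/-- The marginal reward measure `r^S_x = f^⟨1,S⟩_x - f^⟨0,S⟩_x`. -/
noncomputable def marginalReward (B : Bandit X) (S : Finset X) (x : X) : ℝ :=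
  B.rewardMeasure (Policy.firstThen true S) x - B.rewardMeasure (Policy.firstThen false S) x

/-- The marginal productivity measure `ν^S_x = r^S_x / w^S_x`. -/
noncomputable def marginalProductivity (B : Bandit X) (S : Finset X) (x : X) : ℝ :=
  B.marginalReward S x / B.marginalWork S x

end Bandit

/-! ## Projects with switching costs -/

/-- A finite-state project with startup costs `c`, shutdown costs `d`, active rewards `R`,
active transition probabilities `p` and discount factor `β`, where `c i + d i ≥ 0`. -/
structure Project (N : Type*) [Fintype N] where
  β : ℝ
  β_pos : 0 < β
  β_lt_one : β < 1
  p : N → N → ℝ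
  p_nonneg : ∀ i j, 0 ≤ p i j
  p_sum : ∀ i, ∑ j, p i j = 1
  R : N → ℝ
  c : N → ℝ
  d : N → ℝ
  cost_nonneg : ∀ i, 0 ≤ c i + d i

/-- A (possibly randomized) stopping rule for the state process of a continuously engaged
project: given the past states, latest first, and the current state, the probability of
continuing for one more period. -/
def StoppingRule (N : Type*) : Type _ := List N → N → unitInterval

namespace Project

variable {N : Type*} [Fintype N]

/-- The normalized project without shutdown costs: startup costs `c + d` and active rewards
`R + (I - β P) d`. -/
def normalized (P : Project N) : Project N where
  β := P.β
  β_pos := P.β_pos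
  β_lt_one := P.β_lt_one
  p := P.p
  p_nonneg := P.p_nonneg
  p_sum := P.p_sum
  R := fun i => P.R i + (P.d i - P.β * ∑ j, P.p i j * P.d j)
  c := fun i => P.c i + P.d i
  d := fun _ => 0
  cost_nonneg := fun i => by simpa using P.cost_nonneg i

/-- The restless reformulation on the augmented states `(a⁻, i)`, where `a⁻` is the previous
action. -/
def restless [DecidableEq N] (P : Project N) : Bandit (Bool × N) where
  discount := P.β
  trans := fun a x y =>
    if a = true then (if y.1 = true then P.p x.2 y.2 else 0)
    else (if y = (false, x.2) then 1 else 0)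
  reward := fun a x =>
    if a = true then P.R x.2 - (if x.1 = true then 0 else P.c x.2)
    else - (if x.1 = true then P.d x.2 else 0)

/-- The underlying nonrestless project without switching costs. -/
def base [DecidableEq N] (P : Project N) : Bandit N where
  discount := P.β
  trans := fun a i j => if a = true then P.p i j else (if j = i then 1 else 0)
  reward := fun a i => if a = true then P.R i else 0

/-- `P.alive σ q t h i` is the conditional expectation of `1{τ > t} q (X(t))` for the stopping
time `τ` given by `σ`, when the past states are `h`, the present state is `i`, and stopping has
not occurred before the present period.
In particular `P.alive σ q t [] i = E_i^τ[1{τ > t} q (X(t))]`. -/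
noncomputable def alive (P : Project N) (σ : StoppingRule N) (q : N → ℝ) :
    ℕ → List N → N → ℝ
  | 0, h, i => (σ h i : ℝ) * q i
  | t + 1, h, i => (σ h i : ℝ) * ∑ j : N, P.p i j * alive P σ q t (i :: h) j

/-- `E_i^τ[∑_{t < τ} q (X(t)) βᵗ]`. -/
noncomputable def untilStop (P : Project N) (σ : StoppingRule N) (q : N → ℝ) (i : N) : ℝ :=
  ∑' t : ℕ, P.β ^ t * P.alive σ q t [] i

/-- `v` is the Asawa–Teneketzis (AT) index of a project without shutdown costs at the augmented
state `(a, i)`: the maximum over stopping times `τ > 0` of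
`E_i^τ[-(1 - a) c_i + ∑_{t < τ} R(X(t)) βᵗ] / E_i^τ[∑_{t < τ} βᵗ]`. -/
def IsATIndex (P : Project N) (a : Bool) (i : N) (v : ℝ) : Prop :=
  IsGreatest {u : ℝ | ∃ σ : StoppingRule N, σ [] i = 1 ∧
    u = (-(if a = true then 0 else P.c i) + P.untilStop σ P.R i)
      / P.untilStop σ (fun _ => 1) i} v

end Project

/-! ## First stage: the continuation-index algorithm -/

/-- The format of the output of the continuation-index algorithm `AG¹`.  The first arguments
run over `k = 1, …, n`, where `n` is the number of states. -/
structure AG1Data (N : Type*) where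
  /-- `pivot k` is the `k`-th picked state `i₁ᵏ` -/
  pivot : ℕ → N
  /-- `index k` is the continuation index of the state `pivot k` -/
  index : ℕ → ℝ
  /-- `w k j` is `w^{(k)}_j`, for `j` among the first `k` picked states -/
  w : ℕ → N → ℝ
  /-- `ν k j` is `ν^{(k)}_j`, for `j` among the first `k` picked states -/
  ν : ℕ → N → ℝ

/-- The set `S₁ᵏ` of the first `k` picked states. -/
def AG1Data.activeSet {N : Type*} [DecidableEq N] (D : AG1Data N) (k : ℕ) : Finset N :=
  (Finset.Icc 1 k).image D.pivot

/-- `D` is an output of algorithm `AG¹` for the project `P`, with ties broken in any way. -/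
structure Project.IsAG1Output {N : Type*} [Fintype N] [DecidableEq N] (P : Project N)
    (D : AG1Data N) : Prop where
  /-- `i₁ᵏ` is picked outside `S₁ᵏ⁻¹`, -/
  pivot_notMem : ∀ k, 1 ≤ k → k ≤ Fintype.card N → D.pivot k ∉ D.activeSet (k - 1)
  /-- and maximizes `ν^{(k-1)}` there. -/
  pivot_max : ∀ k, 1 ≤ k → k ≤ Fintype.card N → ∀ i, i ∉ D.activeSet (k - 1) →
    P.base.marginalProductivity (D.activeSet (k - 1)) i
      ≤ P.base.marginalProductivity (D.activeSet (k - 1)) (D.pivot k)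
  index_eq : ∀ k, 1 ≤ k → k ≤ Fintype.card N →
    D.index k = P.base.marginalProductivity (D.activeSet (k - 1)) (D.pivot k)
  w_eq : ∀ k, 1 ≤ k → k ≤ Fintype.card N → ∀ j ∈ D.activeSet k,
    D.w k j = P.base.marginalWork (D.activeSet k) j
  ν_eq : ∀ k, 1 ≤ k → k ≤ Fintype.card N → ∀ j ∈ D.activeSet k,
    D.ν k j = P.base.marginalProductivity (D.activeSet k) j

/-! ## Second stage: the switching-index algorithm -/

/-- A rule for the instruction "pick `j ∈ arg max {φ j : j ∈ s}`", breaking ties in some way.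
(A run of the algorithm below never picks twice from the same set, so that every way of breaking
ties during a run comes from such a rule.) -/
structure ArgMaxRule (N : Type*) where
  pick : Finset N → (N → ℝ) → N
  pick_mem : ∀ (s : Finset N) (φ : N → ℝ), s.Nonempty → pick s φ ∈ s
  le_pick : ∀ (s : Finset N) (φ : N → ℝ), ∀ j ∈ s, φ j ≤ φ (pick s φ)

namespace AG0

variable {N : Type*}

/-- The variables of algorithm `AG⁰`: the counter `k₀`, the sets `S₀` and `S₁`, and the list of
the pairs `(i₀ᵏ, ν*_{(0, i₀ᵏ)})` produced so far, in this order. -/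
structure State (N : Type*) where
  k₀ : ℕ
  S₀ : Finset N
  S₁ : Finset N
  out : List (N × ℝ)

variable [DecidableEq N]

/-- The inner loop
`while k₀ < k₁ and not AUGMENT₁ do`
`  pick j ∈ arg max {score j : j ∈ S₁ \ S₀}`
`  if k₁ = n or ν*_{i₁^{k₁+1}} < score j then output (j, score j), S₀ := S₀ ∪ {j}, k₀ := k₀ + 1`
`  else AUGMENT₁ := true`. -/
noncomputable def whileLoop (rule : ArgMaxRule N) (D : AG1Data N) (n k₁ : ℕ) (score : N → ℝ)
    (s : State N) : State N :=
  if s.k₀ < k₁ then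
    let j := rule.pick (s.S₁ \ s.S₀) score
    if k₁ = n ∨ D.index (k₁ + 1) < score j then
      whileLoop rule D n k₁ score
        { k₀ := s.k₀ + 1, S₀ := insert j s.S₀, S₁ := s.S₁, out := s.out ++ [(j, score j)] }
    else s
  else s
termination_by k₁ - s.k₀

/-- The body of the outer loop `for k₁ := 1 to n`: the set `S₁` is augmented by `i₁^{k₁}`, the
numbers `ν^{(k₁)}_j - (1 - β) c_j / w^{(k₁)}_j` are computed (they are read only for
`j ∈ S₁ \ S₀`), and the inner loop is run. -/
noncomputable def forBody (rule : ArgMaxRule N) (β : ℝ) (c : N → ℝ) (D : AG1Data N) (n k₁ : ℕ)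
    (s : State N) : State N :=
  whileLoop rule D n k₁ (fun j => D.ν k₁ j - (1 - β) * c j / D.w k₁ j)
    { s with S₁ := insert (D.pivot k₁) s.S₁ }

/-- The variables of the algorithm after the first `k` rounds of the outer loop. -/
noncomputable def run (rule : ArgMaxRule N) (β : ℝ) (c : N → ℝ) (D : AG1Data N) (n : ℕ) :
    ℕ → State N
  | 0 => { k₀ := 0, S₀ := ∅, S₁ := ∅, out := [] }
  | k + 1 => forBody rule β c D n (k + 1) (run rule β c D n k)

/-- The output `(i₀ᵏ, ν*_{(0, i₀ᵏ)})`, `k = 1, …, n`, of the switching-index algorithm `AG⁰` with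
discount factor `β`, startup costs `c`, input `D`, and ties broken by `rule`. -/
noncomputable def output [Fintype N] (rule : ArgMaxRule N) (β : ℝ) (c : N → ℝ)
    (D : AG1Data N) : List (N × ℝ) :=
  (run rule β c D (Fintype.card N) (Fintype.card N)).out

end AG0

/-! Everything reduces to one optimal stopping problem for the normalized project. Let `A ν i` be
its optimal net reward at wage `ν` when it is engaged now and may be abandoned free of charge later,
so that `A ν = R - ν + β P max(A ν, 0)` (`continuation`). In `ν` it is continuous and falls with
slope at most `-1`, so there is exactly one wage at which it equals the startup cost still to be
paid: `0` if already engaged, `c i` if rested. That wage is `switchingIndex`.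

It is the MPI because the restless Bellman equation has the explicit solution `max(A, 0) - d` in
`(1, i)` and `max(A - c, 0)` in `(0, i)`. As normalized startup costs are nonnegative, resting in
order to re-engage later never pays, and engaging is strictly better iff `A` exceeds the cost
(`isMPI_switchingIndex`). It is the AT index because `A ν i` is the maximum of reward minus `ν`
times work over stopping rules that engage first, and a ratio is maximal at the wage where the
maximal net value vanishes (`isATIndex_switchingIndex`).

For the algorithms, the key fact is that on the wage interval between the continuation indices `k +
1` and `k` the set of the first `k` pivots is optimal (`IsAG1Output.continuation_eq_engagedNet`).
There `A ν j` is affine in `ν`, and solving `A ν j = c j` gives precisely the score used by AG⁰.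
Hence the score of a remaining state is its switching index, unless both lie at or below the next
continuation index (`agScore_eq_or`). Round `k` therefore outputs, in decreasing order, exactly the
remaining states whose index exceeds the next continuation index, and the last round outputs all the
rest. -/

/-! ## Comparison for discounted sums along a sub-Markov operator -/

section SubMarkov

variable {Z : Type*}

/-- A linear operator on functions that is positive and does not increase constants. -/
structure IsSubMarkov (L : (Z → ℝ) →ₗ[ℝ] (Z → ℝ)) : Prop where
  mono : Monotone L
  one_le : L 1 ≤ 1

variable {L : (Z → ℝ) →ₗ[ℝ] (Z → ℝ)} {β : ℝ} {s : ℕ → Z → ℝ}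

theorem IsSubMarkov.map_const_le (hL : IsSubMarkov L) {C : ℝ} (hC : 0 ≤ C) :
    L (C • (1 : Z → ℝ)) ≤ C • (1 : Z → ℝ) := by
  rw [map_smul]
  exact smul_le_smul_of_nonneg_left hL.one_le hC

/-- Conditioning on the first period, the partial sums satisfy `T (n + 1) = s 0 + β L (T n)`, and
`W` is a supersolution of the same recursion. The term `β ^ n * C` is the discounted deficit of
starting from `T 0 = 0` when `W` is only known to be at least `-C`. -/
theorem IsSubMarkov.sum_range_le (hL : IsSubMarkov L) (hβ : 0 ≤ β)
    (hs : ∀ t, s (t + 1) = L (s t)) {W : Z → ℝ} {C : ℝ} (hC : 0 ≤ C)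
    (hW : s 0 + β • L W ≤ W) (hWC : -(C • (1 : Z → ℝ)) ≤ W) (n : ℕ) :
    ∑ t ∈ Finset.range n, β ^ t • s t ≤ W + (β ^ n * C) • (1 : Z → ℝ) := by
  induction n with
  | zero => intro z; have := hWC z; simp at this ⊢; linarith
  | succ n ih =>
    have h1 : ∑ t ∈ Finset.range (n + 1), β ^ t • s t
        = s 0 + β • L (∑ t ∈ Finset.range n, β ^ t • s t) := by
      rw [Finset.sum_range_succ', map_sum, Finset.smul_sum, add_comm]
      simp only [pow_zero, one_smul, map_smul, smul_smul, hs, pow_succ']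
    have h2 := hL.mono ih
    rw [map_add] at h2
    have h3 := hL.map_const_le (C := β ^ n * C) (by positivity)
    rw [h1]
    intro z
    have h2z := h2 z
    have h3z := h3 z
    have hWz := hW z
    simp only [Pi.add_apply, Pi.smul_apply, smul_eq_mul, Pi.one_apply, mul_one] at *
    have := mul_le_mul_of_nonneg_left (h2z.trans (add_le_add_right h3z _)) hβ
    rw [pow_succ']
    linarith

theorem IsSubMarkov.abs_le (hL : IsSubMarkov L) (hs : ∀ t, s (t + 1) = L (s t)) {M : ℝ}
    (hM : ∀ z, |s 0 z| ≤ M) (t : ℕ) (z : Z) : |s t z| ≤ M := by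
  have hM0 : 0 ≤ M := (abs_nonneg _).trans (hM z)
  have key : s t ≤ M • (1 : Z → ℝ) ∧ -(M • (1 : Z → ℝ)) ≤ s t := by
    induction t with
    | zero =>
      exact ⟨fun z => by simpa using (_root_.abs_le.1 (hM z)).2, fun z => by
        simpa using (_root_.abs_le.1 (hM z)).1⟩
    | succ t ih =>
      rw [hs]
      refine ⟨(hL.mono ih.1).trans (hL.map_const_le hM0), ?_⟩
      refine le_trans ?_ (hL.mono ih.2)
      rw [map_neg]
      exact neg_le_neg (hL.map_const_le hM0)
  have h1 := key.1 z
  have h2 := key.2 z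
  simp at h1 h2
  exact _root_.abs_le.2 ⟨h2, h1⟩

theorem IsSubMarkov.summable (hL : IsSubMarkov L) (hβ : 0 ≤ β) (hβ1 : β < 1)
    (hs : ∀ t, s (t + 1) = L (s t)) {M : ℝ} (hM : ∀ z, |s 0 z| ≤ M) (z : Z) :
    Summable fun t => β ^ t * s t z := by
  refine Summable.of_norm_bounded (g := fun t => β ^ t * M)
    ((summable_geometric_of_lt_one hβ hβ1).mul_right M) fun t => ?_
  rw [norm_mul, Real.norm_eq_abs, Real.norm_eq_abs, abs_of_nonneg (pow_nonneg hβ t)]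
  exact mul_le_mul_of_nonneg_left (hL.abs_le hs hM t z) (pow_nonneg hβ t)

/-- The verification principle behind the evaluation of both policies and stopping rules: a bounded
supersolution dominates the discounted sum. -/
theorem IsSubMarkov.tsum_le (hL : IsSubMarkov L) (hβ : 0 ≤ β) (hβ1 : β < 1)
    (hs : ∀ t, s (t + 1) = L (s t)) {M : ℝ} (hM : ∀ z, |s 0 z| ≤ M) {W : Z → ℝ} {C : ℝ}
    (hW : s 0 + β • L W ≤ W) (hWC : ∀ z, |W z| ≤ C) (z : Z) :
    ∑' t, β ^ t * s t z ≤ W z := by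
  have hC : 0 ≤ C := (abs_nonneg _).trans (hWC z)
  have h1 := (hL.summable hβ hβ1 hs hM z).hasSum.tendsto_sum_nat
  have h2 : Filter.Tendsto (fun n : ℕ => W z + β ^ n * C) Filter.atTop (nhds (W z + 0 * C)) :=
    ((tendsto_pow_atTop_nhds_zero_of_lt_one hβ hβ1).mul_const C).const_add _
  rw [zero_mul, add_zero] at h2
  refine le_of_tendsto_of_tendsto' h1 h2 fun n => ?_
  have := hL.sum_range_le hβ hs hC hW
    (fun z => by simpa using (_root_.abs_le.1 (hWC z)).1) n z
  simpa using this

end SubMarkov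

theorem exists_forall_abs_le {X : Type*} [Finite X] (f : X → ℝ) : ∃ C, ∀ x, |f x| ≤ C := by
  obtain ⟨C, hC⟩ := (Set.finite_range fun x => |f x|).bddAbove
  exact ⟨C, fun x => hC ⟨x, rfl⟩⟩

/-- The comparison functions used below treat the empty history separately, because the first
decision is prescribed and need not obey the rule followed afterwards. -/
theorem exists_forall_abs_le_of_list {X Y : Type*} [Finite X] (f g : X → ℝ) :
    ∃ C, ∀ z : List Y × X, |(if z.1 = [] then f z.2 else g z.2)| ≤ C := by
  obtain ⟨C, hC⟩ := exists_forall_abs_le f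
  obtain ⟨C', hC'⟩ := exists_forall_abs_le g
  refine ⟨max C C', fun z => ?_⟩
  split_ifs
  · exact (hC _).trans (le_max_left _ _)
  · exact (hC' _).trans (le_max_right _ _)

/-! ## Policy evaluation -/

namespace Policy

variable {X : Type*}

theorem prob_nonneg (π : Policy X) (h : List (X × Bool)) (x : X) (a : Bool) :
    0 ≤ π.prob h x a := by
  unfold prob
  split_ifs
  · exact (π h x).2.1
  · linarith [(π h x).2.2]

theorem sum_prob_mul (π : Policy X) (h : List (X × Bool)) (x : X) (u : Bool → ℝ) :
    ∑ a, π.prob h x a * u a = (π h x : ℝ) * u true + (1 - π h x) * u false := by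
  simp [prob]

theorem sum_prob_mul_of_eq_sure {π : Policy X} {h : List (X × Bool)} {x : X} {b : Bool}
    (hb : π h x = sure b) (u : Bool → ℝ) : ∑ a, π.prob h x a * u a = u b := by
  rw [sum_prob_mul, hb]
  cases b <;> simp [sure]

theorem sum_prob_mul_le {π : Policy X} {h : List (X × Bool)} {x : X} {u : Bool → ℝ} {v : ℝ}
    (hu : ∀ a, u a ≤ v) : ∑ a, π.prob h x a * u a ≤ v := by
  rw [sum_prob_mul]
  nlinarith [hu true, hu false, (π h x).2.1, (π h x).2.2]

end Policy

namespace Bandit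

variable {X : Type*} [Fintype X]

/-- The discount factor lies in `[0, 1)` and the transition matrices are stochastic. -/
structure IsStochastic (B : Bandit X) : Prop where
  discount_nonneg : 0 ≤ B.discount
  discount_lt_one : B.discount < 1
  trans_nonneg : ∀ a x y, 0 ≤ B.trans a x y
  trans_sum : ∀ a x, ∑ y, B.trans a x y = 1

/-- The one-period transition operator on functions of the history and the state. -/
noncomputable def transOp (B : Bandit X) (π : Policy X) :
    (List (X × Bool) × X → ℝ) →ₗ[ℝ] (List (X × Bool) × X → ℝ) where
  toFun f z := ∑ a, π.prob z.1 z.2 a * ∑ y, B.trans a z.2 y * f ((z.2, a) :: z.1, y)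
  map_add' f g := by
    ext z; simp only [Pi.add_apply, mul_add, Finset.sum_add_distrib]
  map_smul' r f := by
    ext z
    simp only [Pi.smul_apply, smul_eq_mul, RingHom.id_apply, Finset.mul_sum]
    exact Finset.sum_congr rfl fun a _ => Finset.sum_congr rfl fun y _ => by ring

theorem IsStochastic.isSubMarkov {B : Bandit X} (hB : B.IsStochastic) (π : Policy X) :
    IsSubMarkov (B.transOp π) where
  mono f g hfg z := by
    simp only [transOp, LinearMap.coe_mk, AddHom.coe_mk]
    gcongr with a _ y _
    · exact π.prob_nonneg _ _ _
    · exact hB.trans_nonneg _ _ _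
    · exact hfg _
  one_le z := by
    simp only [transOp, LinearMap.coe_mk, AddHom.coe_mk, Pi.one_apply, mul_one, hB.trans_sum]
    simpa using Policy.sum_prob_mul_le (π := π) (h := z.1) (x := z.2) (u := fun _ => 1)
      fun _ => le_refl (1 : ℝ)

theorem exists_abs_sum_prob_le (π : Policy X) (q : Bool → X → ℝ) :
    ∃ M, ∀ z : List (X × Bool) × X, |∑ a, π.prob z.1 z.2 a * q a z.2| ≤ M := by
  obtain ⟨M, hM⟩ := exists_forall_abs_le fun z : Bool × X => q z.1 z.2
  refine ⟨M, fun z => abs_le.2 ⟨?_, ?_⟩⟩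
  · have := Policy.sum_prob_mul_le (π := π) (h := z.1) (x := z.2) (u := fun a => -q a z.2)
      (v := M) fun a => (neg_le_abs _).trans (hM (a, z.2))
    simp only [mul_neg, Finset.sum_neg_distrib] at this
    linarith
  · exact Policy.sum_prob_mul_le fun a => (le_abs_self _).trans (hM (a, z.2))

theorem IsStochastic.summable {B : Bandit X} (hB : B.IsStochastic) (π : Policy X)
    (q : Bool → X → ℝ) (x : X) : Summable fun t => B.discount ^ t * B.stage π q t [] x := by
  obtain ⟨M, hM⟩ := exists_abs_sum_prob_le π q
  exact (hB.isSubMarkov π).summable (s := fun t z => B.stage π q t z.1 z.2) hB.discount_nonneg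
    hB.discount_lt_one (fun t => rfl) hM ([], x)

theorem stage_sub_mul (B : Bandit X) (π : Policy X) (q r : Bool → X → ℝ) (ν : ℝ) (t : ℕ)
    (h : List (X × Bool)) (x : X) :
    B.stage π (fun a x => q a x - ν * r a x) t h x
      = B.stage π q t h x - ν * B.stage π r t h x := by
  induction t generalizing h x with
  | zero =>
    simp only [stage, Finset.mul_sum, ← Finset.sum_sub_distrib]
    exact Finset.sum_congr rfl fun a _ => by ring
  | succ t ih =>
    simp only [stage, ih, Finset.mul_sum, ← Finset.sum_sub_distrib]
    exact Finset.sum_congr rfl fun a _ => Finset.sum_congr rfl fun y _ => by ring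

theorem IsStochastic.total_sub_mul {B : Bandit X} (hB : B.IsStochastic) (π : Policy X)
    (q r : Bool → X → ℝ) (ν : ℝ) (x : X) :
    B.total π (fun a x => q a x - ν * r a x) x = B.total π q x - ν * B.total π r x := by
  unfold total
  rw [← tsum_mul_left, ← (hB.summable π q x).tsum_sub ((hB.summable π r x).mul_left ν)]
  exact tsum_congr fun t => by rw [stage_sub_mul]; ring

/-- The value of taking action `a` in state `x` and continuing with the values `V`. -/
noncomputable def lookahead (B : Bandit X) (q : Bool → X → ℝ) (V : X → ℝ) (a : Bool) (x : X) :
    ℝ :=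
  q a x + B.discount * ∑ y, B.trans a x y * V y

/-- The supersolution inequality is required only after the initial period, so that policies with a
forced first action are covered. -/
theorem IsStochastic.total_le {B : Bandit X} (hB : B.IsStochastic) {π : Policy X}
    {q : Bool → X → ℝ} {V : X → ℝ}
    (hV : ∀ h ≠ [], ∀ x, ∑ a, π.prob h x a * B.lookahead q V a x ≤ V x) (x : X) :
    B.total π q x ≤ ∑ a, π.prob [] x a * B.lookahead q V a x := by
  obtain ⟨M, hM⟩ := exists_abs_sum_prob_le π q
  obtain ⟨C, hC⟩ := exists_forall_abs_le_of_list (Y := X × Bool)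
    (fun x => ∑ a, π.prob [] x a * B.lookahead q V a x) V
  have := (hB.isSubMarkov π).tsum_le (s := fun t z => B.stage π q t z.1 z.2) hB.discount_nonneg
    hB.discount_lt_one (fun t => rfl) hM
    (W := fun z => if z.1 = [] then ∑ a, π.prob [] z.2 a * B.lookahead q V a z.2 else V z.2)
    ?_ hC ([], x)
  · rwa [if_pos rfl] at this
  · rintro ⟨h, x⟩
    have h1 : ((fun z : List (X × Bool) × X => B.stage π q 0 z.1 z.2) + B.discount •
        B.transOp π fun z : List (X × Bool) × X =>
          if z.1 = [] then ∑ a, π.prob [] z.2 a * B.lookahead q V a z.2 else V z.2) (h, x)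
        = ∑ a, π.prob h x a * B.lookahead q V a x := by
      simp only [Pi.add_apply, stage, Pi.smul_apply, transOp, LinearMap.coe_mk, AddHom.coe_mk,
        smul_eq_mul, reduceCtorEq, if_false, lookahead, mul_add, Finset.sum_add_distrib,
        Finset.mul_sum]
      congr 1
      exact Finset.sum_congr rfl fun a _ => Finset.sum_congr rfl fun y _ => by ring
    rw [h1]
    dsimp only
    split_ifs with hh
    · rw [hh]
    · exact hV h hh x

/-- Negating rewards turns the upper bound `total_le` into a lower bound. The shape `0 - 1 * q` is
the one to which `total_sub_mul` applies. -/
theorem lookahead_neg (B : Bandit X) (q : Bool → X → ℝ) (V : X → ℝ) (a : Bool) (x : X) :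
    B.lookahead (fun a x => 0 - 1 * q a x) (fun x => -V x) a x = -B.lookahead q V a x := by
  simp only [lookahead, mul_neg, Finset.sum_neg_distrib]
  ring

theorem IsStochastic.total_eq {B : Bandit X} (hB : B.IsStochastic) {π : Policy X}
    {q : Bool → X → ℝ} {V : X → ℝ}
    (hV : ∀ h ≠ [], ∀ x, ∑ a, π.prob h x a * B.lookahead q V a x = V x) (x : X) :
    B.total π q x = ∑ a, π.prob [] x a * B.lookahead q V a x := by
  refine le_antisymm (hB.total_le (fun h hh x => (hV h hh x).le) x) ?_
  have h0 : B.total π (fun _ _ => 0) x = 0 := by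
    have := hB.total_sub_mul π (fun _ _ => 0) (fun _ _ => 0) 1 x
    simp only [mul_zero, sub_zero, one_mul] at this
    linarith
  have := hB.total_le (π := π) (q := fun a x => 0 - 1 * q a x) (V := fun x => -V x)
    (fun h hh x => by
      simp only [lookahead_neg, mul_neg, Finset.sum_neg_distrib, hV h hh x, le_refl]) x
  rw [hB.total_sub_mul, h0] at this
  simp only [lookahead_neg, mul_neg, Finset.sum_neg_distrib] at this
  linarith

/-- The one-period reward of the `ν`-wage problem. -/
noncomputable def netReward (B : Bandit X) (ν : ℝ) (a : Bool) (x : X) : ℝ :=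
  B.reward a x - ν * if a = true then 1 else 0

theorem IsStochastic.netValue_eq {B : Bandit X} (hB : B.IsStochastic) (ν : ℝ) (π : Policy X)
    (x : X) : B.netValue ν π x = B.total π (B.netReward ν) x :=
  (hB.total_sub_mul π _ _ ν x).symm

/-- A solution of the Bellman equation determines the optimal actions. -/
theorem IsStochastic.isOptimalAction_iff {B : Bandit X} (hB : B.IsStochastic) {ν : ℝ}
    {V : X → ℝ} (hle : ∀ a x, B.lookahead (B.netReward ν) V a x ≤ V x)
    (hex : ∀ x, ∃ a, B.lookahead (B.netReward ν) V a x = V x) (b : Bool) (x : X) :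
    B.IsOptimalAction ν b x ↔ B.lookahead (B.netReward ν) V b x = V x := by
  choose g hg using hex
  have ub : ∀ π : Policy X, B.netValue ν π x
      ≤ ∑ a, π.prob [] x a * B.lookahead (B.netReward ν) V a x := fun π => by
    rw [hB.netValue_eq]
    exact hB.total_le (fun h _ x => Policy.sum_prob_mul_le fun a => hle a x) x
  -- Taking `b` once and the maximizing action `g` ever after attains the lookahead value of `b`.
  have val : ∀ b, ∃ π : Policy X, π [] x = Policy.sure b ∧
      B.netValue ν π x = B.lookahead (B.netReward ν) V b x := fun b => by
    obtain ⟨π, h0, h1⟩ : ∃ π : Policy X, π [] x = Policy.sure b ∧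
        ∀ h ≠ [], ∀ y, π h y = Policy.sure (g y) :=
      ⟨fun h y => if h = [] then Policy.sure b else Policy.sure (g y), if_pos rfl,
        fun h hh y => if_neg hh⟩
    refine ⟨π, h0, ?_⟩
    rw [hB.netValue_eq, hB.total_eq (V := V), Policy.sum_prob_mul_of_eq_sure h0]
    intro h hh y
    rw [Policy.sum_prob_mul_of_eq_sure (h1 h hh y), hg]
  constructor
  · rintro ⟨π, hopt, hπ⟩
    refine le_antisymm (hle b x) ?_
    obtain ⟨π', -, hval⟩ := val (g x)
    have h1 := hopt π'
    have h2 := ub π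
    rw [Policy.sum_prob_mul_of_eq_sure hπ] at h2
    rw [hval, hg] at h1
    exact h1.trans h2
  · intro hb
    obtain ⟨π, hπ, hval⟩ := val b
    refine ⟨π, fun π' => ?_, hπ⟩
    rw [hval, hb]
    exact (ub π').trans (Policy.sum_prob_mul_le fun a => hle a x)

theorem IsStochastic.mem_minimalActiveSet_iff {B : Bandit X} (hB : B.IsStochastic) {ν : ℝ}
    {V : X → ℝ} (hV : ∀ x, V x = max (B.lookahead (B.netReward ν) V true x)
      (B.lookahead (B.netReward ν) V false x)) (x : X) :
    x ∈ B.minimalActiveSet ν ↔ B.lookahead (B.netReward ν) V false x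
      < B.lookahead (B.netReward ν) V true x := by
  have hle : ∀ a x, B.lookahead (B.netReward ν) V a x ≤ V x := fun a x => by
    rw [hV x]; cases a <;> simp
  have hex : ∀ x, ∃ a, B.lookahead (B.netReward ν) V a x = V x := fun x => by
    rcases max_choice (B.lookahead (B.netReward ν) V true x)
      (B.lookahead (B.netReward ν) V false x) with h | h
    · exact ⟨true, by rw [hV x, h]⟩
    · exact ⟨false, by rw [hV x, h]⟩
  unfold minimalActiveSet
  rw [Set.mem_ofPred_eq, hB.isOptimalAction_iff hle hex, hB.isOptimalAction_iff hle hex]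
  generalize hu : B.lookahead (B.netReward ν) V true x = u
  generalize hw : B.lookahead (B.netReward ν) V false x = w
  rw [hV x, hu, hw, eq_comm, max_eq_left_iff, eq_comm (a := w), max_eq_right_iff, not_le]
  exact ⟨fun h => h.2, fun h => ⟨h.le, h⟩⟩

end Bandit

/-! ## Evaluation of stopping rules -/

namespace Project

variable {N : Type*} [Fintype N]

/-- The one-period transition operator of a continuously engaged project that is stopped
according to `σ`, on functions of the past states and the present state. -/
noncomputable def stopOp (P : Project N) (σ : StoppingRule N) :
    (List N × N → ℝ) →ₗ[ℝ] (List N × N → ℝ) where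
  toFun f z := (σ z.1 z.2 : ℝ) * ∑ j, P.p z.2 j * f (z.2 :: z.1, j)
  map_add' f g := by
    ext z; simp only [Pi.add_apply, mul_add, Finset.sum_add_distrib]
  map_smul' r f := by
    ext z
    simp only [Pi.smul_apply, smul_eq_mul, RingHom.id_apply, Finset.mul_sum]
    exact Finset.sum_congr rfl fun y _ => by ring

theorem isSubMarkov_stopOp (P : Project N) (σ : StoppingRule N) :
    IsSubMarkov (P.stopOp σ) where
  mono f g hfg z := mul_le_mul_of_nonneg_left (Finset.sum_le_sum fun y _ =>
      mul_le_mul_of_nonneg_left (hfg _) (P.p_nonneg _ _)) (σ _ _).2.1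
  one_le z := by
    simp only [stopOp, LinearMap.coe_mk, AddHom.coe_mk, Pi.one_apply, mul_one, P.p_sum]
    exact (σ _ _).2.2

theorem exists_abs_mul_le (σ : StoppingRule N) (q : N → ℝ) :
    ∃ M, ∀ z : List N × N, |(σ z.1 z.2 : ℝ) * q z.2| ≤ M := by
  obtain ⟨M, hM⟩ := exists_forall_abs_le q
  refine ⟨M, fun z => ?_⟩
  rw [abs_mul, abs_of_nonneg (σ z.1 z.2).2.1]
  nlinarith [hM z.2, abs_nonneg (q z.2), (σ z.1 z.2).2.2, (σ z.1 z.2).2.1]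

theorem summable_alive (P : Project N) (σ : StoppingRule N) (q : N → ℝ) (i : N) :
    Summable fun t => P.β ^ t * P.alive σ q t [] i := by
  obtain ⟨M, hM⟩ := exists_abs_mul_le σ q
  exact (P.isSubMarkov_stopOp σ).summable (s := fun t z => P.alive σ q t z.1 z.2) P.β_pos.le
    P.β_lt_one (fun t => rfl) hM ([], i)

theorem alive_sub_mul (P : Project N) (σ : StoppingRule N) (q r : N → ℝ) (ν : ℝ) (t : ℕ)
    (h : List N) (i : N) :
    P.alive σ (fun i => q i - ν * r i) t h i = P.alive σ q t h i - ν * P.alive σ r t h i := by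
  induction t generalizing h i with
  | zero => simp only [alive]; ring
  | succ t ih =>
    simp only [alive, ih, Finset.mul_sum, ← Finset.sum_sub_distrib]
    exact Finset.sum_congr rfl fun y _ => by ring

theorem untilStop_sub_mul (P : Project N) (σ : StoppingRule N) (q r : N → ℝ) (ν : ℝ) (i : N) :
    P.untilStop σ (fun i => q i - ν * r i) i
      = P.untilStop σ q i - ν * P.untilStop σ r i := by
  unfold untilStop
  rw [← tsum_mul_left, ← (P.summable_alive σ q i).tsum_sub ((P.summable_alive σ r i).mul_left ν)]
  exact tsum_congr fun t => by rw [alive_sub_mul]; ring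

theorem untilStop_le (P : Project N) {σ : StoppingRule N} {q V : N → ℝ}
    (hV : ∀ h ≠ [], ∀ i, (σ h i : ℝ) * (q i + P.β * ∑ j, P.p i j * V j) ≤ V i) (i : N) :
    P.untilStop σ q i ≤ (σ [] i : ℝ) * (q i + P.β * ∑ j, P.p i j * V j) := by
  obtain ⟨M, hM⟩ := exists_abs_mul_le σ q
  obtain ⟨C, hC⟩ := exists_forall_abs_le_of_list (Y := N)
    (fun i => (σ [] i : ℝ) * (q i + P.β * ∑ j, P.p i j * V j)) V
  have := (P.isSubMarkov_stopOp σ).tsum_le (s := fun t z => P.alive σ q t z.1 z.2) P.β_pos.le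
    P.β_lt_one (fun t => rfl) hM
    (W := fun z => if z.1 = [] then
      (σ [] z.2 : ℝ) * (q z.2 + P.β * ∑ j, P.p z.2 j * V j) else V z.2)
    ?_ hC ([], i)
  · rwa [if_pos rfl] at this
  · rintro ⟨h, i⟩
    have h1 : ((fun z : List N × N => P.alive σ q 0 z.1 z.2) + P.β •
        P.stopOp σ fun z : List N × N => if z.1 = [] then
          (σ [] z.2 : ℝ) * (q z.2 + P.β * ∑ j, P.p z.2 j * V j) else V z.2) (h, i)
        = (σ h i : ℝ) * (q i + P.β * ∑ j, P.p i j * V j) := by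
      simp only [Pi.add_apply, alive, Pi.smul_apply, stopOp, LinearMap.coe_mk, AddHom.coe_mk,
        smul_eq_mul, reduceCtorEq, if_false]
      ring
    rw [h1]
    dsimp only
    split_ifs with hh
    · rw [hh]
    · exact hV h hh i

theorem untilStop_eq (P : Project N) {σ : StoppingRule N} {q V : N → ℝ}
    (hV : ∀ h ≠ [], ∀ i, (σ h i : ℝ) * (q i + P.β * ∑ j, P.p i j * V j) = V i) (i : N) :
    P.untilStop σ q i = (σ [] i : ℝ) * (q i + P.β * ∑ j, P.p i j * V j) := by
  refine le_antisymm (P.untilStop_le (fun h hh x => (hV h hh x).le) i) ?_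
  have h0 : P.untilStop σ (fun _ => 0) i = 0 := by
    have := P.untilStop_sub_mul σ (fun _ => 0) (fun _ => 0) 1 i
    simp only [mul_zero, sub_zero, one_mul] at this
    linarith
  have hneg : ∀ i, 0 - 1 * q i + P.β * ∑ j, P.p i j * -V j
      = -(q i + P.β * ∑ j, P.p i j * V j) := fun i => by
    simp only [mul_neg, Finset.sum_neg_distrib]; ring
  have := P.untilStop_le (σ := σ) (q := fun i => 0 - 1 * q i) (V := fun x => -V x)
    (fun h hh x => by rw [hneg, mul_neg, hV h hh x]) i
  rw [untilStop_sub_mul, h0, hneg] at this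
  linarith

theorem alive_nonneg (P : Project N) (σ : StoppingRule N) {q : N → ℝ} (hq : ∀ i, 0 ≤ q i)
    (t : ℕ) (h : List N) (i : N) : 0 ≤ P.alive σ q t h i := by
  induction t generalizing h i with
  | zero => exact mul_nonneg (σ h i).2.1 (hq i)
  | succ t ih =>
    exact mul_nonneg (σ h i).2.1 (Finset.sum_nonneg fun j _ => mul_nonneg (P.p_nonneg i j) (ih _ _))

theorem one_le_untilStop_one (P : Project N) {σ : StoppingRule N} {i : N} (hσ : σ [] i = 1) :
    1 ≤ P.untilStop σ (fun _ => 1) i := by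
  have := (P.summable_alive σ (fun _ => 1) i).le_tsum 0 fun t _ =>
    mul_nonneg (pow_nonneg P.β_pos.le t) (P.alive_nonneg σ (fun _ => zero_le_one) t [] i)
  simpa [alive, hσ, untilStop] using this

end Project

/-! ## Discounted fixed-point equations -/

/-- The functions `U j` are monotone and 1-Lipschitz. -/
def IsMonotoneNonexpansive {N : Type*} (U : N → ℝ → ℝ) : Prop :=
  ∀ j x y, U j x ≤ U j y + max (x - y) 0

theorem isMonotoneNonexpansive_posPart {N : Type*} :
    IsMonotoneNonexpansive fun (_ : N) x => max x 0 := fun _ x y => by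
  dsimp only
  refine max_le ?_ ?_
  · linarith [le_max_left y 0, le_max_left (x - y) 0]
  · linarith [le_max_right y 0, le_max_right (x - y) 0]

theorem isMonotoneNonexpansive_indicator {N : Type*} [DecidableEq N] (S : Finset N) :
    IsMonotoneNonexpansive fun (j : N) x => if j ∈ S then x else 0 := fun j x y => by
  dsimp only
  split_ifs
  · linarith [le_max_left (x - y) 0]
  · linarith [le_max_right (x - y) 0]

theorem IsMonotoneNonexpansive.abs_sub_le {N : Type*} {U : N → ℝ → ℝ}
    (hU : IsMonotoneNonexpansive U) (j : N) (x y : ℝ) : |U j x - U j y| ≤ |x - y| := by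
  refine abs_le.2 ⟨?_, ?_⟩
  · have h := hU j y x
    have : max (y - x) 0 ≤ |x - y| := max_le (by rw [abs_sub_comm]; exact le_abs_self _)
      (abs_nonneg _)
    linarith
  · have h := hU j x y
    have : max (x - y) 0 ≤ |x - y| := max_le (le_abs_self _) (abs_nonneg _)
    linarith

namespace Project

variable {N : Type*} [Fintype N]

theorem sum_p_mul_le (P : Project N) {f : N → ℝ} {m : ℝ} (hf : ∀ j, f j ≤ m) (i : N) :
    ∑ j, P.p i j * f j ≤ m := by
  calc ∑ j, P.p i j * f j ≤ ∑ j, P.p i j * m :=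
        Finset.sum_le_sum fun j _ => mul_le_mul_of_nonneg_left (hf j) (P.p_nonneg i j)
    _ = m := by rw [← Finset.sum_mul, P.p_sum, one_mul]

/-- A maximum principle: at a state where `f - g` is largest, a positive gap would be at most `β`
times itself. -/
theorem le_of_subsolution (P : Project N) {U : N → ℝ → ℝ} (hU : IsMonotoneNonexpansive U)
    {q f g : N → ℝ} (hf : ∀ i, f i ≤ q i + P.β * ∑ j, P.p i j * U j (f j))
    (hg : ∀ i, q i + P.β * ∑ j, P.p i j * U j (g j) ≤ g i) (i : N) : f i ≤ g i := by
  have : Nonempty N := ⟨i⟩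
  obtain ⟨k, hk⟩ := Finite.exists_max fun i => f i - g i
  have h1 : ∑ j, P.p k j * (U j (f j) - U j (g j)) ≤ max (f k - g k) 0 :=
    P.sum_p_mul_le (fun j => by
      have := hU j (f j) (g j)
      have := max_le_max_right 0 (hk j)
      linarith) k
  simp only [mul_sub, Finset.sum_sub_distrib] at h1
  have h2 := mul_le_mul_of_nonneg_left h1 P.β_pos.le
  have h3 := hf k
  have h4 := hg k
  have h5 : f k - g k ≤ P.β * max (f k - g k) 0 := by linarith
  have h6 : f k - g k ≤ 0 := by
    by_contra! hpos
    rw [max_eq_left hpos.le] at h5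
    nlinarith [P.β_lt_one]
  linarith [hk i]

theorem eq_of_fixedPoint (P : Project N) {U : N → ℝ → ℝ} (hU : IsMonotoneNonexpansive U)
    {q f g : N → ℝ} (hf : ∀ i, f i = q i + P.β * ∑ j, P.p i j * U j (f j))
    (hg : ∀ i, g i = q i + P.β * ∑ j, P.p i j * U j (g j)) : f = g :=
  funext fun i => le_antisymm
    (P.le_of_subsolution hU (fun i => (hf i).le) (fun i => (hg i).ge) i)
    (P.le_of_subsolution hU (fun i => (hg i).le) (fun i => (hf i).ge) i)

theorem exists_fixedPoint (P : Project N) {U : N → ℝ → ℝ} (hU : IsMonotoneNonexpansive U)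
    (q : N → ℝ) : ∃ f : N → ℝ, ∀ i, f i = q i + P.β * ∑ j, P.p i j * U j (f j) := by
  have hT : ContractingWith (NNReal.mk P.β P.β_pos.le)
      (fun (f : N → ℝ) i => q i + P.β * ∑ j, P.p i j * U j (f j)) := by
    refine ⟨by rw [← NNReal.coe_lt_coe, NNReal.coe_mk]; exact P.β_lt_one,
      LipschitzWith.of_dist_le_mul fun f g => ?_⟩
    refine (dist_pi_le_iff (mul_nonneg (NNReal.coe_nonneg _) dist_nonneg)).2 fun i => ?_
    have key : ∀ f g : N → ℝ, ∑ j, P.p i j * (U j (f j) - U j (g j)) ≤ dist f g := fun f g =>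
      P.sum_p_mul_le (fun j => (le_abs_self _).trans
        ((hU.abs_sub_le j _ _).trans (dist_le_pi_dist f g j))) i
    have h1 := key f g
    have h2 := key g f
    rw [dist_comm g f] at h2
    simp only [mul_sub, Finset.sum_sub_distrib] at h1 h2
    have h3 := mul_le_mul_of_nonneg_left h1 P.β_pos.le
    have h4 := mul_le_mul_of_nonneg_left h2 P.β_pos.le
    rw [Real.dist_eq, NNReal.coe_mk]
    exact abs_le.2 ⟨by linarith, by linarith⟩
  exact ⟨hT.fixedPoint, fun i => (congrFun hT.fixedPoint_isFixedPt i).symm⟩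

/-! ## The optimal stopping problem -/

/-- The optimal net reward of the project without switching costs at the wage `ν` when it must
be engaged in the initial period and may be abandoned at any later period. -/
noncomputable def continuation (P : Project N) (ν : ℝ) : N → ℝ :=
  (P.exists_fixedPoint isMonotoneNonexpansive_posPart fun i => P.R i - ν).choose

theorem continuation_eq (P : Project N) (ν : ℝ) (i : N) :
    P.continuation ν i = P.R i - ν + P.β * ∑ j, P.p i j * max (P.continuation ν j) 0 :=
  (P.exists_fixedPoint isMonotoneNonexpansive_posPart fun i => P.R i - ν).choose_spec i

theorem sum_p_mul_add (P : Project N) (f : N → ℝ) (m : ℝ) (i : N) :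
    ∑ j, P.p i j * (f j + m) = ∑ j, P.p i j * f j + m := by
  simp only [mul_add, Finset.sum_add_distrib, ← Finset.sum_mul, P.p_sum, one_mul]

theorem sum_p_mul_mono (P : Project N) {f g : N → ℝ} (h : ∀ j, f j ≤ g j) (i : N) :
    ∑ j, P.p i j * f j ≤ ∑ j, P.p i j * g j :=
  Finset.sum_le_sum fun j _ => mul_le_mul_of_nonneg_left (h j) (P.p_nonneg i j)

/-- The initial period is always engaged, so raising the wage costs at least the increase: shifting
the value at `ν'` up by `ν' - ν` gives a subsolution at `ν`. -/
theorem continuation_add_le (P : Project N) {ν ν' : ℝ} (h : ν ≤ ν') (i : N) :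
    P.continuation ν' i + (ν' - ν) ≤ P.continuation ν i := by
  refine P.le_of_subsolution (q := fun i => P.R i - ν) isMonotoneNonexpansive_posPart
    (f := fun i => P.continuation ν' i + (ν' - ν)) (fun i => ?_)
    (fun i => (P.continuation_eq ν i).ge) i
  have h1 := mul_le_mul_of_nonneg_left (P.sum_p_mul_mono (f := fun j => max (P.continuation ν' j) 0)
    (g := fun j => max (P.continuation ν' j + (ν' - ν)) 0)
    (fun j => max_le_max_right 0 (by linarith)) i) P.β_pos.le
  have h2 := P.continuation_eq ν' i
  linarith

/-- The discounted work is at most `(1 - β)⁻¹`, which bounds the effect of a change of wage. -/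
theorem continuation_le_add (P : Project N) (ν ν' : ℝ) (i : N) :
    P.continuation ν' i ≤ P.continuation ν i + (1 - P.β)⁻¹ * |ν' - ν| := by
  have hβ : 0 < 1 - P.β := by linarith [P.β_lt_one]
  set m := (1 - P.β)⁻¹ * |ν' - ν| with hm
  have hm0 : 0 ≤ m := by positivity
  have hm1 : |ν' - ν| = m - P.β * m := by rw [hm]; field_simp
  refine P.le_of_subsolution (q := fun i => P.R i - ν') isMonotoneNonexpansive_posPart
    (g := fun i => P.continuation ν i + m) (fun i => (P.continuation_eq ν' i).le) (fun i => ?_) i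
  have h1 := P.sum_p_mul_mono (f := fun j => max (P.continuation ν j + m) 0)
    (g := fun j => max (P.continuation ν j) 0 + m)
    (fun j => max_le (by linarith [le_max_left (P.continuation ν j) 0])
      (by linarith [le_max_right (P.continuation ν j) 0])) i
  rw [sum_p_mul_add] at h1
  have h2 := mul_le_mul_of_nonneg_left h1 P.β_pos.le
  have h3 := P.continuation_eq ν i
  have h4 := neg_abs_le (ν' - ν)
  linarith

theorem continuation_strictAnti (P : Project N) (i : N) :
    StrictAnti fun ν => P.continuation ν i := fun ν ν' h => by
  have := P.continuation_add_le h.le i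
  dsimp only
  linarith

theorem exists_continuation_eq (P : Project N) (i : N) (b : ℝ) :
    ∃ ν, P.continuation ν i = b := by
  have hc : Continuous fun ν => P.continuation ν i :=
    (LipschitzWith.of_le_add_mul' (1 - P.β)⁻¹ fun ν' ν => by
      rw [Real.dist_eq]; exact P.continuation_le_add ν ν' i).continuous
  -- As the slope is at most `-1`, moving the wage from `0` by the distance between `A 0 i` and `b`
  -- is enough to cross `b`.
  refine mem_range_of_exists_le_of_exists_ge hc ⟨|P.continuation 0 i - b|, ?_⟩
    ⟨-|P.continuation 0 i - b|, ?_⟩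
  · have := P.continuation_add_le (abs_nonneg (P.continuation 0 i - b)) i
    linarith [le_abs_self (P.continuation 0 i - b)]
  · have := P.continuation_add_le (neg_nonpos.2 (abs_nonneg (P.continuation 0 i - b))) i
    linarith [neg_abs_le (P.continuation 0 i - b)]

/-- The wage at which the continuation value equals the startup cost to be paid in the augmented
state `x`. -/
noncomputable def switchingIndex (P : Project N) (x : Bool × N) : ℝ :=
  (P.exists_continuation_eq x.2 (if x.1 = true then 0 else P.c x.2)).choose

theorem continuation_switchingIndex (P : Project N) (x : Bool × N) :
    P.continuation (P.switchingIndex x) x.2 = if x.1 = true then 0 else P.c x.2 :=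
  (P.exists_continuation_eq x.2 _).choose_spec

theorem lt_switchingIndex_iff (P : Project N) (ν : ℝ) (x : Bool × N) :
    ν < P.switchingIndex x ↔ (if x.1 = true then 0 else P.c x.2) < P.continuation ν x.2 := by
  rw [← P.continuation_switchingIndex x]
  exact (P.continuation_strictAnti x.2).lt_iff_gt.symm

/-! ## The switching index is the MPI -/

theorem isStochastic_restless [DecidableEq N] (P : Project N) : P.restless.IsStochastic where
  discount_nonneg := P.β_pos.le
  discount_lt_one := P.β_lt_one
  trans_nonneg a x y := by
    dsimp only [restless]
    split_ifs <;> first | exact P.p_nonneg _ _ | norm_num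
  trans_sum a x := by
    dsimp only [restless]
    cases a
    · simp
    · simp [Fintype.sum_prod_type, P.p_sum]

/-- The optimal value of the wage problem in the augmented states. -/
noncomputable def restlessValue (P : Project N) (ν : ℝ) (x : Bool × N) : ℝ :=
  if x.1 = true then max (P.normalized.continuation ν x.2) 0 - P.d x.2
  else max (P.normalized.continuation ν x.2 - P.normalized.c x.2) 0

/-- The `-d` in the values at engaged states turns `R` into the normalized reward `R + d - β P d`,
less `d i`. In a rested state this `d i` joins `c i` to form the normalized startup cost. -/
theorem lookahead_restlessValue_true [DecidableEq N] (P : Project N) (ν : ℝ) (x : Bool × N) :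
    P.restless.lookahead (P.restless.netReward ν) (P.restlessValue ν) true x
      = P.normalized.continuation ν x.2 - (if x.1 = true then 0 else P.normalized.c x.2)
        - if x.1 = true then P.d x.2 else 0 := by
  have h := P.normalized.continuation_eq ν x.2
  simp only [Bandit.lookahead, Bandit.netReward, restless, restlessValue, Fintype.sum_prod_type,
    Fintype.sum_bool, if_true, Bool.false_eq_true, if_false, zero_mul, Finset.sum_const_zero,
    add_zero, mul_sub, Finset.sum_sub_distrib]
  rw [h]
  simp only [normalized]
  split_ifs <;> ring

theorem lookahead_restlessValue_false [DecidableEq N] (P : Project N) (ν : ℝ) (x : Bool × N) :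
    P.restless.lookahead (P.restless.netReward ν) (P.restlessValue ν) false x
      = P.β * max (P.normalized.continuation ν x.2 - P.normalized.c x.2) 0
        - if x.1 = true then P.d x.2 else 0 := by
  simp only [Bandit.lookahead, Bandit.netReward, restless, Bool.false_eq_true, if_false, ite_mul,
    one_mul, zero_mul, Finset.sum_ite_eq', Finset.mem_univ, if_true, restlessValue]
  ring

theorem isMPI_switchingIndex [DecidableEq N] (P : Project N) :
    P.restless.IsMPI P.normalized.switchingIndex := by
  intro ν
  ext x
  have hc : 0 ≤ P.normalized.c x.2 := P.cost_nonneg x.2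
  have hβ := P.β_pos
  have hβ1 := P.β_lt_one
  -- Bellman equation. Nonnegativity of the normalized cost yields `β max(A - c, 0) ≤ max(A, 0)`, so
  -- re-engaging after a rest adds nothing in an engaged state.
  have hV : ∀ x, P.restlessValue ν x
      = max (P.restless.lookahead (P.restless.netReward ν) (P.restlessValue ν) true x)
        (P.restless.lookahead (P.restless.netReward ν) (P.restlessValue ν) false x) := fun x => by
    have hc : 0 ≤ P.normalized.c x.2 := P.cost_nonneg x.2
    rw [lookahead_restlessValue_true, lookahead_restlessValue_false]
    unfold restlessValue
    generalize P.normalized.continuation ν x.2 = A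
    generalize P.normalized.c x.2 = c at hc
    rw [max_sub_sub_right]
    split_ifs
    · rw [sub_zero]
      congr 1
      rcases le_total (A - c) 0 with h | h
      · rw [max_eq_right h, mul_zero]
      · rw [max_eq_left h, max_eq_left (by linarith), max_eq_left (by nlinarith)]
    · rw [sub_zero]
      rcases le_total (A - c) 0 with h | h
      · rw [max_eq_right h, mul_zero, max_eq_right h]
      · rw [max_eq_left h, max_eq_left (by nlinarith)]
  rw [P.isStochastic_restless.mem_minimalActiveSet_iff hV, lookahead_restlessValue_true,
    lookahead_restlessValue_false, Set.mem_ofPred_eq, lt_switchingIndex_iff]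
  generalize P.normalized.continuation ν x.2 = A
  generalize P.normalized.c x.2 = c at hc
  rw [sub_lt_sub_iff_right]
  split_ifs
  · rcases le_total (A - c) 0 with h | h
    · rw [max_eq_right h, mul_zero, sub_zero]
    · rw [max_eq_left h, sub_zero]
      constructor
      · intro h1
        by_contra! h2
        nlinarith
      · intro h1
        nlinarith
  · rcases le_total (A - c) 0 with h | h
    · rw [max_eq_right h, mul_zero, sub_pos]
    · rw [max_eq_left h]
      constructor
      · intro h1
        by_contra! h2
        nlinarith
      · intro h1
        nlinarith

/-! ## The switching index is the AT index -/

theorem untilStop_sub_le_continuation (P : Project N) {σ : StoppingRule N} {i : N}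
    (hσ : σ [] i = 1) (ν : ℝ) :
    P.untilStop σ P.R i - ν * P.untilStop σ (fun _ => 1) i ≤ P.continuation ν i := by
  rw [← untilStop_sub_mul]
  simp only [mul_one]
  have := P.untilStop_le (σ := σ) (q := fun i => P.R i - ν)
    (V := fun j => max (P.continuation ν j) 0) (fun h _ j => ?_) i
  · rwa [hσ, ← P.continuation_eq ν i, Set.Icc.coe_one, one_mul] at this
  · rw [← P.continuation_eq ν j]
    rcases le_total (P.continuation ν j) 0 with h0 | h0
    · rw [max_eq_right h0]
      nlinarith [(σ h j).2.1]
    · rw [max_eq_left h0]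
      nlinarith [(σ h j).2.2]

/-- After the forced first period, continue exactly while the continuation value is positive. -/
theorem exists_untilStop_sub_eq_continuation (P : Project N) (i : N) (ν : ℝ) :
    ∃ σ : StoppingRule N, σ [] i = 1 ∧
      P.untilStop σ P.R i - ν * P.untilStop σ (fun _ => 1) i = P.continuation ν i := by
  classical
  obtain ⟨σ, h0, h1⟩ : ∃ σ : StoppingRule N, σ [] i = 1 ∧
      ∀ h ≠ [], ∀ j, σ h j = if 0 < P.continuation ν j then 1 else 0 :=
    ⟨fun h j => if h = [] then 1 else if 0 < P.continuation ν j then 1 else 0, if_pos rfl,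
      fun h hh j => if_neg hh⟩
  refine ⟨σ, h0, ?_⟩
  rw [← untilStop_sub_mul]
  simp only [mul_one]
  rw [P.untilStop_eq (V := fun j => max (P.continuation ν j) 0) (fun h hh j => ?_), h0,
    ← P.continuation_eq ν i, Set.Icc.coe_one, one_mul]
  rw [← P.continuation_eq ν j, h1 h hh]
  split_ifs with h
  · rw [max_eq_left h.le, Set.Icc.coe_one, one_mul]
  · rw [max_eq_right (not_lt.1 h), Set.Icc.coe_zero, zero_mul]

/-- The denominator is at least `1`, so a ratio is at most `ν` iff its numerator minus `ν` times the
denominator is at most `0`. At the switching index the largest such difference is `0`. -/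
theorem isATIndex_switchingIndex (P : Project N) (x : Bool × N) :
    P.IsATIndex x.1 x.2 (P.switchingIndex x) := by
  have hx := P.continuation_switchingIndex x
  constructor
  · obtain ⟨σ, hσ, h⟩ := P.exists_untilStop_sub_eq_continuation x.2 (P.switchingIndex x)
    refine ⟨σ, hσ, ?_⟩
    have := P.one_le_untilStop_one hσ
    rw [eq_div_iff (by linarith)]
    linarith
  · rintro u ⟨σ, hσ, rfl⟩
    have h := P.untilStop_sub_le_continuation hσ (P.switchingIndex x)
    have := P.one_le_untilStop_one hσ
    rw [div_le_iff₀ (by linarith)]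
    linarith

/-! ## Marginal productivity of the project without switching costs -/

variable [DecidableEq N]

/-- The expected total discounted sum of `q` while the project is engaged, when it is engaged in
the initial period and thereafter until its state leaves `S`. -/
noncomputable def engagedTotal (P : Project N) (S : Finset N) (q : N → ℝ) : N → ℝ :=
  (P.exists_fixedPoint (isMonotoneNonexpansive_indicator S) q).choose

theorem engagedTotal_eq (P : Project N) (S : Finset N) (q : N → ℝ) (i : N) :
    P.engagedTotal S q i
      = q i + P.β * ∑ j, P.p i j * if j ∈ S then P.engagedTotal S q j else 0 :=
  (P.exists_fixedPoint (isMonotoneNonexpansive_indicator S) q).choose_spec i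

theorem one_le_engagedTotal_one (P : Project N) (S : Finset N) (i : N) :
    1 ≤ P.engagedTotal S (fun _ => 1) i := by
  have h : ∀ i, 0 ≤ P.engagedTotal S (fun _ => 1) i := fun i =>
    P.le_of_subsolution (isMonotoneNonexpansive_indicator S) (f := fun _ => 0)
      (q := fun _ => 1) (fun i => by simp) (fun i => (P.engagedTotal_eq S (fun _ => 1) i).ge) i
  rw [engagedTotal_eq]
  have : 0 ≤ P.β * ∑ j, P.p i j * if j ∈ S then P.engagedTotal S (fun _ => 1) j else 0 :=
    mul_nonneg P.β_pos.le (Finset.sum_nonneg fun j _ => mul_nonneg (P.p_nonneg i j) (by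
      split_ifs
      · exact h j
      · exact le_rfl))
  linarith

theorem isStochastic_base (P : Project N) : P.base.IsStochastic where
  discount_nonneg := P.β_pos.le
  discount_lt_one := P.β_lt_one
  trans_nonneg a x y := by
    dsimp only [base]
    split_ifs <;> first | exact P.p_nonneg _ _ | norm_num
  trans_sum a x := by
    dsimp only [base]
    cases a
    · simp
    · simp [P.p_sum]

/-- Resting freezes the state: it merely delays the `S`-active policy by one period if `i ∈ S`, and
otherwise the project is never engaged again. -/
theorem total_firstThen (P : Project N) (S : Finset N) (q : N → ℝ) (a : Bool) (i : N) :
    P.base.total (Policy.firstThen a S) (fun a i => if a = true then q i else 0) i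
      = if a = true then P.engagedTotal S q i
        else P.β * if i ∈ S then P.engagedTotal S q i else 0 := by
  set V : N → ℝ := fun i => if i ∈ S then P.engagedTotal S q i else 0 with hV
  have hla : ∀ a i, P.base.lookahead (fun a i => if a = true then q i else 0) V a i
      = if a = true then P.engagedTotal S q i else P.β * V i := fun a i => by
    cases a
    · simp [Bandit.lookahead, base]
    · simp only [Bandit.lookahead, base, if_true]
      exact (P.engagedTotal_eq S q i).symm
  rw [P.isStochastic_base.total_eq (V := V), Policy.sum_prob_mul_of_eq_sure (b := a) rfl, hla]
  intro h hh j
  obtain ⟨y, h, rfl⟩ := List.exists_cons_of_ne_nil hh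
  rw [Policy.sum_prob_mul_of_eq_sure (b := decide (j ∈ S)) rfl, hla]
  by_cases hj : j ∈ S <;> simp [hV, hj]

theorem marginalWork_base (P : Project N) (S : Finset N) (i : N) :
    P.base.marginalWork S i = P.engagedTotal S (fun _ => 1) i
      - P.β * if i ∈ S then P.engagedTotal S (fun _ => 1) i else 0 := by
  unfold Bandit.marginalWork Bandit.workMeasure
  rw [P.total_firstThen S (fun _ => 1) true i, P.total_firstThen S (fun _ => 1) false i]
  simp

theorem marginalReward_base (P : Project N) (S : Finset N) (i : N) :
    P.base.marginalReward S i = P.engagedTotal S P.R i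
      - P.β * if i ∈ S then P.engagedTotal S P.R i else 0 := by
  have h : P.base.reward = fun a i => if a = true then P.R i else 0 := rfl
  unfold Bandit.marginalReward Bandit.rewardMeasure
  rw [h, P.total_firstThen S P.R true i, P.total_firstThen S P.R false i]
  simp

/-- For `i ∈ S` both marginal measures carry the factor `1 - β`, which cancels. -/
theorem marginalProductivity_base (P : Project N) (S : Finset N) (i : N) :
    P.base.marginalProductivity S i
      = P.engagedTotal S P.R i / P.engagedTotal S (fun _ => 1) i := by
  unfold Bandit.marginalProductivity
  rw [marginalWork_base, marginalReward_base]
  split_ifs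
  · have hβ : (1 - P.β) ≠ 0 := by linarith [P.β_lt_one]
    rw [← one_sub_mul, ← one_sub_mul, mul_div_mul_left _ _ hβ]
  · simp

end Project

theorem AG1Data.activeSet_succ {N : Type*} [DecidableEq N] (D : AG1Data N) (k : ℕ) :
    D.activeSet (k + 1) = insert (D.pivot (k + 1)) (D.activeSet k) := by
  unfold AG1Data.activeSet
  rw [← Finset.insert_Icc_right_eq_Icc_add_one (by omega), Finset.image_insert]

namespace Project

variable {N : Type*} [Fintype N] [DecidableEq N]

/-! ## The continuation-index algorithm -/

/-- The net reward at the wage `ν` when the project is engaged in the initial period and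
thereafter until its state leaves `S`. -/
noncomputable def engagedNet (P : Project N) (S : Finset N) (ν : ℝ) (i : N) : ℝ :=
  P.engagedTotal S P.R i - ν * P.engagedTotal S (fun _ => 1) i

theorem engagedNet_eq (P : Project N) (S : Finset N) (ν : ℝ) (i : N) :
    P.engagedNet S ν i
      = P.R i - ν + P.β * ∑ j, P.p i j * if j ∈ S then P.engagedNet S ν j else 0 := by
  have h : ∑ j, P.p i j * (if j ∈ S then P.engagedNet S ν j else 0)
      = (∑ j, P.p i j * if j ∈ S then P.engagedTotal S P.R j else 0)
        - ν * ∑ j, P.p i j * if j ∈ S then P.engagedTotal S (fun _ => 1) j else 0 := by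
    rw [Finset.mul_sum, ← Finset.sum_sub_distrib]
    refine Finset.sum_congr rfl fun j _ => ?_
    unfold engagedNet
    split_ifs <;> ring
  rw [h]
  have h1 := P.engagedTotal_eq S P.R i
  have h2 := P.engagedTotal_eq S (fun _ => 1) i
  unfold engagedNet
  linear_combination h1 - ν * h2

theorem engagedNet_antitone (P : Project N) (S : Finset N) (i : N) :
    Antitone fun ν => P.engagedNet S ν i := fun ν ν' h => by
  have := P.one_le_engagedTotal_one S i
  dsimp only [engagedNet]
  nlinarith

theorem engagedNet_nonneg_iff (P : Project N) (S : Finset N) (ν : ℝ) (i : N) :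
    0 ≤ P.engagedNet S ν i ↔ ν ≤ P.base.marginalProductivity S i := by
  have := P.one_le_engagedTotal_one S i
  rw [marginalProductivity_base, le_div_iff₀ (by linarith), engagedNet, sub_nonneg]

theorem engagedNet_nonpos_iff (P : Project N) (S : Finset N) (ν : ℝ) (i : N) :
    P.engagedNet S ν i ≤ 0 ↔ P.base.marginalProductivity S i ≤ ν := by
  have := P.one_le_engagedTotal_one S i
  rw [marginalProductivity_base, div_le_iff₀ (by linarith), engagedNet, sub_nonpos]

/-- Engaging exactly in `S` solves the optimal stopping problem when the signs of the resulting
continuation values agree with this decision. -/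
theorem continuation_eq_engagedNet (P : Project N) {S : Finset N} {ν : ℝ}
    (hS : ∀ i ∈ S, 0 ≤ P.engagedNet S ν i) (hSc : ∀ i ∉ S, P.engagedNet S ν i ≤ 0) :
    P.continuation ν = P.engagedNet S ν := by
  refine P.eq_of_fixedPoint isMonotoneNonexpansive_posPart (P.continuation_eq ν) fun i => ?_
  rw [engagedNet_eq]
  congr 2
  refine Finset.sum_congr rfl fun j _ => ?_
  congr 1
  split_ifs with hj
  · rw [max_eq_left (hS j hj)]
  · rw [max_eq_right (hSc j hj)]

/-- Adding a state with vanishing continuation value does not change the continuation values. -/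
theorem engagedNet_insert (P : Project N) {S : Finset N} {ν : ℝ} {k : N}
    (hk : P.engagedNet S ν k = 0) : P.engagedNet (insert k S) ν = P.engagedNet S ν := by
  refine P.eq_of_fixedPoint (isMonotoneNonexpansive_indicator (insert k S))
    (P.engagedNet_eq (insert k S) ν) fun i => ?_
  rw [engagedNet_eq]
  congr 2
  refine Finset.sum_congr rfl fun j _ => ?_
  congr 1
  by_cases hj : j = k
  · subst hj; simp [hk]
  · simp [hj]

namespace IsAG1Output

variable {P : Project N} {D : AG1Data N}

theorem card_activeSet (hD : P.IsAG1Output D) {k : ℕ} (hk : k ≤ Fintype.card N) :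
    (D.activeSet k).card = k := by
  induction k with
  | zero => simp [AG1Data.activeSet]
  | succ k ih =>
    rw [AG1Data.activeSet_succ, Finset.card_insert_of_notMem, ih (by omega)]
    exact hD.pivot_notMem (k + 1) (by omega) hk

theorem engagedNet_pivot (hD : P.IsAG1Output D) {k : ℕ} (hk : k + 1 ≤ Fintype.card N) :
    P.engagedNet (D.activeSet k) (D.index (k + 1)) (D.pivot (k + 1)) = 0 := by
  have h := hD.index_eq (k + 1) (by omega) hk
  rw [Nat.add_sub_cancel] at h
  exact le_antisymm ((P.engagedNet_nonpos_iff _ _ _).2 h.ge)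
    ((P.engagedNet_nonneg_iff _ _ _).2 h.le)

theorem engagedNet_nonpos (hD : P.IsAG1Output D) {k : ℕ} (hk : k + 1 ≤ Fintype.card N) {ν : ℝ}
    (hν : D.index (k + 1) ≤ ν) {i : N} (hi : i ∉ D.activeSet k) :
    P.engagedNet (D.activeSet k) ν i ≤ 0 := by
  rw [engagedNet_nonpos_iff]
  have h := hD.index_eq (k + 1) (by omega) hk
  have h1 := hD.pivot_max (k + 1) (by omega) hk i
  rw [Nat.add_sub_cancel] at h h1
  exact (h1 hi).trans (h.symm.le.trans hν)

/-- At the wage `D.index (k + 1)` the new pivot has net value zero, so adding it changes no value.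
Older members stay nonnegative because the wage has not risen, and outside states are nonpositive
because the pivot maximizes the productivity. -/
theorem engagedNet_signs (hD : P.IsAG1Output D) {k : ℕ} (hk : k + 1 ≤ Fintype.card N) :
    (∀ i ∈ D.activeSet (k + 1), 0 ≤ P.engagedNet (D.activeSet (k + 1)) (D.index (k + 1)) i) ∧
    ∀ i ∉ D.activeSet (k + 1), P.engagedNet (D.activeSet (k + 1)) (D.index (k + 1)) i ≤ 0 := by
  induction k with
  | zero =>
    have h0 := hD.engagedNet_pivot hk
    rw [AG1Data.activeSet_succ, P.engagedNet_insert h0]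
    refine ⟨fun i hi => ?_, fun i hi => ?_⟩
    · have : i = D.pivot (0 + 1) := by simpa [AG1Data.activeSet] using hi
      rw [this, h0]
    · exact hD.engagedNet_nonpos hk le_rfl fun h => hi (Finset.mem_insert_of_mem h)
  | succ k ih =>
    have h0 := hD.engagedNet_pivot hk
    obtain ⟨ih1, ih2⟩ := ih (by omega)
    -- The next pivot lies outside the current set, where the induction hypothesis bounds the
    -- productivity by the current index.
    have hidx : D.index (k + 1 + 1) ≤ D.index (k + 1) := by
      have h := hD.index_eq (k + 1 + 1) (by omega) hk
      have h1 := hD.pivot_notMem (k + 1 + 1) (by omega) hk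
      rw [Nat.add_sub_cancel] at h h1
      rw [h]
      exact (P.engagedNet_nonpos_iff _ _ _).1 (ih2 _ h1)
    rw [AG1Data.activeSet_succ D (k + 1), P.engagedNet_insert h0]
    refine ⟨fun i hi => ?_, fun i hi => ?_⟩
    · rcases Finset.mem_insert.1 hi with rfl | hi
      · exact h0.ge
      · exact (ih1 i hi).trans (P.engagedNet_antitone _ i hidx)
    · exact hD.engagedNet_nonpos hk le_rfl fun h => hi (Finset.mem_insert_of_mem h)

theorem index_succ_le (hD : P.IsAG1Output D) {k : ℕ} (hk1 : 1 ≤ k)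
    (hk : k + 1 ≤ Fintype.card N) : D.index (k + 1) ≤ D.index k := by
  obtain ⟨k, rfl⟩ := Nat.exists_eq_add_of_le' hk1
  have h := hD.index_eq (k + 1 + 1) (by omega) hk
  have h1 := hD.pivot_notMem (k + 1 + 1) (by omega) hk
  rw [Nat.add_sub_cancel] at h h1
  rw [h]
  exact (P.engagedNet_nonpos_iff _ _ _).1 ((hD.engagedNet_signs (by omega)).2 _ h1)

/-- Between two successive continuation indices, engaging in the states picked so far is optimal
in the optimal stopping problem. -/
theorem continuation_eq_engagedNet (hD : P.IsAG1Output D) {k : ℕ} (hk1 : 1 ≤ k)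
    (hk : k ≤ Fintype.card N) {ν : ℝ} (hν : ν ≤ D.index k)
    (hν' : k < Fintype.card N → D.index (k + 1) ≤ ν) :
    P.continuation ν = P.engagedNet (D.activeSet k) ν := by
  obtain ⟨m, rfl⟩ := Nat.exists_eq_add_of_le' hk1
  refine P.continuation_eq_engagedNet (fun i hi => ?_) fun i hi => ?_
  · exact ((hD.engagedNet_signs hk).1 i hi).trans (P.engagedNet_antitone _ i hν)
  · rcases hk.lt_or_eq with h | h
    · exact hD.engagedNet_nonpos h (hν' h) hi
    · refine absurd ?_ hi
      rw [Finset.eq_univ_of_card _ ((hD.card_activeSet hk).trans h)]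
      exact Finset.mem_univ i

/-- At its own continuation index the pivot has continuation value `0`, which does not exceed its
startup cost. -/
theorem switchingIndex_pivot_le (hD : P.IsAG1Output D) {k : ℕ} (hk1 : 1 ≤ k)
    (hk : k ≤ Fintype.card N) (hc : 0 ≤ P.c (D.pivot k)) :
    P.switchingIndex (false, D.pivot k) ≤ D.index k := by
  rw [← not_lt, lt_switchingIndex_iff,
    hD.continuation_eq_engagedNet hk1 hk le_rfl fun h => hD.index_succ_le hk1 h]
  obtain ⟨m, rfl⟩ := Nat.exists_eq_add_of_le' hk1
  have h0 := hD.engagedNet_pivot hk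
  rw [AG1Data.activeSet_succ, P.engagedNet_insert h0, h0]
  simpa using hc

end IsAG1Output

/-- The numbers `ν^{(k)}_j - (1 - β) c_j / w^{(k)}_j` that the switching-index algorithm
compares in round `k`. -/
noncomputable def agScore (P : Project N) (D : AG1Data N) (k : ℕ) (j : N) : ℝ :=
  D.ν k j - (1 - P.β) * P.c j / D.w k j

namespace IsAG1Output

variable {P : Project N} {D : AG1Data N}

/-- For `j` in the active set, `w` is `1 - β` times the discounted engaged time, so the score is the
wage at which the affine function `engagedNet` takes the value `c j`. -/
theorem lt_agScore_iff (hD : P.IsAG1Output D) {k : ℕ} (hk1 : 1 ≤ k) (hk : k ≤ Fintype.card N)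
    {j : N} (hj : j ∈ D.activeSet k) (ν : ℝ) :
    ν < P.agScore D k j ↔ P.c j < P.engagedNet (D.activeSet k) ν j := by
  have h1 := P.one_le_engagedTotal_one (D.activeSet k) j
  have hβ : 1 - P.β ≠ 0 := by linarith [P.β_lt_one]
  rw [agScore, hD.ν_eq k hk1 hk j hj, hD.w_eq k hk1 hk j hj, marginalWork_base, if_pos hj,
    marginalProductivity_base, ← one_sub_mul, mul_div_mul_left _ _ hβ, ← sub_div,
    lt_div_iff₀ (by linarith), engagedNet]
  constructor <;> intro <;> linarith

/-- In round `k`, the score of a state whose switching index is not above the `k`-th continuation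
index is its switching index, unless neither exceeds the next continuation index. -/
theorem agScore_eq_or (hD : P.IsAG1Output D) {k : ℕ} (hk1 : 1 ≤ k) (hk : k ≤ Fintype.card N)
    {j : N} (hj : j ∈ D.activeSet k) (hle : P.switchingIndex (false, j) ≤ D.index k) :
    P.agScore D k j = P.switchingIndex (false, j) ∨
      (k < Fintype.card N ∧ P.switchingIndex (false, j) ≤ D.index (k + 1) ∧
        P.agScore D k j ≤ D.index (k + 1)) := by
  have key : ∀ ν ≤ D.index k, (k < Fintype.card N → D.index (k + 1) ≤ ν) →
      (ν < P.agScore D k j ↔ ν < P.switchingIndex (false, j)) := fun ν h1 h2 => by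
    rw [hD.lt_agScore_iff hk1 hk hj, lt_switchingIndex_iff,
      hD.continuation_eq_engagedNet hk1 hk h1 h2]
    simp
  by_cases hnext : k < Fintype.card N → D.index (k + 1) ≤ P.switchingIndex (false, j)
  · left
    have h1 := (hD.lt_agScore_iff hk1 hk hj (P.switchingIndex (false, j)))
    have h2 := P.continuation_switchingIndex (false, j)
    rw [hD.continuation_eq_engagedNet hk1 hk hle hnext] at h2
    simp only [Bool.false_eq_true, if_false] at h2
    have h3 := P.one_le_engagedTotal_one (D.activeSet k) j
    have hβ : 1 - P.β ≠ 0 := by linarith [P.β_lt_one]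
    rw [agScore, hD.ν_eq k hk1 hk j hj, hD.w_eq k hk1 hk j hj, marginalWork_base, if_pos hj,
      marginalProductivity_base, ← one_sub_mul, mul_div_mul_left _ _ hβ, ← sub_div,
      div_eq_iff (by linarith), ← h2, engagedNet]
    ring
  · push Not at hnext
    obtain ⟨hlt, h⟩ := hnext
    refine Or.inr ⟨hlt, h.le, ?_⟩
    -- The next continuation index is itself an admissible wage in `key`, so score and switching
    -- index lie on the same side of it.
    rw [← not_lt, key _ (hD.index_succ_le hk1 hlt) fun _ => le_rfl]
    exact h.le.not_gt

end IsAG1Output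

end Project

/-! ## The switching-index algorithm -/

namespace AG0

variable {N : Type*} [DecidableEq N]

/-- The output of a state of the algorithm lists the states in `S₀`, at most once each, with the
values `idx`, in nonincreasing order; all of these values exceed `next` if `last` fails; and they
are not below those of the remaining states of `S₁`. -/
structure State.IsValid (idx : N → ℝ) (last : Prop) (next : ℝ) (s : State N) : Prop where
  subset : s.S₀ ⊆ s.S₁
  k₀_eq : s.k₀ = s.S₀.card
  nodup : (s.out.map Prod.fst).Nodup
  mem_iff : ∀ j, j ∈ s.out.map Prod.fst ↔ j ∈ s.S₀
  snd_eq : ∀ e ∈ s.out, e.2 = idx e.1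
  pairwise : (s.out.map Prod.snd).Pairwise (· ≥ ·)
  le_out : ∀ e ∈ s.out, ∀ j ∈ s.S₁ \ s.S₀, idx j ≤ e.2
  next_lt : ¬ last → ∀ e ∈ s.out, next < e.2

/-- The inner loop outputs states as long as some index exceeds the next continuation index. -/
theorem whileLoop_isValid (rule : ArgMaxRule N) (D : AG1Data N) (n k : ℕ) (idx score : N → ℝ)
    (s : State N) (hs : s.IsValid idx (k = n) (D.index (k + 1))) (hcard : s.S₁.card = k)
    (hscore : ∀ j ∈ s.S₁ \ s.S₀, score j = idx j ∨
      (k ≠ n ∧ idx j ≤ D.index (k + 1) ∧ score j ≤ D.index (k + 1))) :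
    (whileLoop rule D n k score s).S₁ = s.S₁ ∧
    (whileLoop rule D n k score s).IsValid idx (k = n) (D.index (k + 1)) ∧
    ∀ j ∈ s.S₁ \ (whileLoop rule D n k score s).S₀, k ≠ n ∧ idx j ≤ D.index (k + 1) := by
  induction hm : k - s.k₀ generalizing s with
  | zero =>
    rw [whileLoop, if_neg (by omega)]
    refine ⟨rfl, hs, fun j hj => ?_⟩
    -- Here `k₀` has reached the size of `S₁`, so `S₀` exhausts `S₁` and nothing remains.
    rw [Finset.eq_of_subset_of_card_le hs.subset (by have := hs.k₀_eq; omega)] at hj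
    simp at hj
  | succ m ih =>
    have hlt : s.k₀ < k := by omega
    have hne : (s.S₁ \ s.S₀).Nonempty := by
      rw [← Finset.card_pos, Finset.card_sdiff_of_subset hs.subset, ← hs.k₀_eq, hcard]
      omega
    rw [whileLoop, if_pos hlt]
    have hmem := rule.pick_mem _ score hne
    have hmax := rule.le_pick (s.S₁ \ s.S₀) score
    set j := rule.pick (s.S₁ \ s.S₀) score with hj
    dsimp only
    obtain ⟨hj1, hj0⟩ := Finset.mem_sdiff.1 hmem
    by_cases hcond : k = n ∨ D.index (k + 1) < score j
    · rw [if_pos hcond]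
      -- Passing the output test excludes the second alternative of `hscore`.
      have hsj : score j = idx j := by
        rcases hscore j hmem with h | ⟨h1, -, h3⟩
        · exact h
        · rcases hcond with h | h
          · exact absurd h h1
          · exact absurd h h3.not_gt
      have hsub : ∀ i ∈ s.S₁ \ insert j s.S₀, i ∈ s.S₁ \ s.S₀ := fun i hi => by
        simp only [Finset.mem_sdiff, Finset.mem_insert, not_or] at hi ⊢
        exact ⟨hi.1, hi.2.2⟩
      refine ih _ ⟨?_, ?_, ?_, ?_, ?_, ?_, ?_, ?_⟩ hcard (fun i hi => hscore i (hsub i hi))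
        (by dsimp only; omega)
      · exact Finset.insert_subset hj1 hs.subset
      · rw [Finset.card_insert_of_notMem hj0, hs.k₀_eq]
      · rw [List.map_append, List.nodup_append]
        refine ⟨hs.nodup, by simp, fun a ha b hb => ?_⟩
        rw [List.map_singleton, List.mem_singleton] at hb
        rintro rfl
        rw [hb] at ha
        exact hj0 ((hs.mem_iff _).1 ha)
      · intro i
        rw [List.map_append, List.mem_append, hs.mem_iff, Finset.mem_insert, or_comm]
        simp
      · intro e he
        rcases List.mem_append.1 he with he | he
        · exact hs.snd_eq e he
        · rw [List.mem_singleton.1 he]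
          exact hsj
      · rw [List.map_append, List.pairwise_append]
        refine ⟨hs.pairwise, by simp, fun a ha b hb => ?_⟩
        rw [List.map_singleton, List.mem_singleton] at hb
        obtain ⟨e, he, rfl⟩ := List.mem_map.1 ha
        rw [hb, hsj]
        exact hs.le_out e he j hmem
      · intro e he i hi
        have hi' := hsub i hi
        rcases List.mem_append.1 he with he | he
        · exact hs.le_out e he i hi'
        · rw [List.mem_singleton.1 he]
          rcases hscore i hi' with h | ⟨h1, h2, -⟩
          · exact h ▸ hmax i hi'
          · rcases hcond with h | h
            · exact absurd h h1
            · exact h2.trans h.le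
      · intro hn e he
        rcases List.mem_append.1 he with he | he
        · exact hs.next_lt hn e he
        · rw [List.mem_singleton.1 he]
          exact hcond.resolve_left hn
    · rw [if_neg hcond]
      -- The largest score fails the test, hence so does every remaining one.
      push Not at hcond
      refine ⟨rfl, hs, fun i hi => ⟨hcond.1, ?_⟩⟩
      rcases hscore i hi with h | ⟨-, h2, -⟩
      · exact h ▸ (hmax i hi).trans hcond.2
      · exact h2

variable [Fintype N]

/-- Rounds fit together because states left over from round `k` and the new pivot all have switching
index at most `D.index (k + 1)`, while everything already output exceeds it. At `k = n` the entry
`D.index (k + 1)` is meaningless, and the condition `k = Fintype.card N` switches off its use. -/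
theorem run_isValid (rule : ArgMaxRule N) {P : Project N} (hc : ∀ i, 0 ≤ P.c i) {D : AG1Data N}
    (hD : P.IsAG1Output D) {k : ℕ} (hk : k ≤ Fintype.card N) :
    (run rule P.β P.c D (Fintype.card N) k).S₁ = D.activeSet k ∧
    (run rule P.β P.c D (Fintype.card N) k).IsValid (fun j => P.switchingIndex (false, j))
      (k = Fintype.card N) (D.index (k + 1)) ∧
    ∀ j ∈ D.activeSet k \ (run rule P.β P.c D (Fintype.card N) k).S₀,
      k ≠ Fintype.card N ∧ P.switchingIndex (false, j) ≤ D.index (k + 1) := by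
  induction k with
  | zero =>
    refine ⟨by simp [run, AG1Data.activeSet], ⟨?_, ?_, ?_, ?_, ?_, ?_, ?_, ?_⟩, ?_⟩ <;>
      simp [run, AG1Data.activeSet]
  | succ k ih =>
    obtain ⟨ih1, ih2, ih3⟩ := ih (by omega)
    set s := run rule P.β P.c D (Fintype.card N) k with hs
    have hle : ∀ j ∈ D.activeSet (k + 1) \ s.S₀,
        P.switchingIndex (false, j) ≤ D.index (k + 1) := fun j hj => by
      obtain ⟨h1, h2⟩ := Finset.mem_sdiff.1 hj
      rw [AG1Data.activeSet_succ] at h1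
      rcases Finset.mem_insert.1 h1 with rfl | h1
      · exact hD.switchingIndex_pivot_le (by omega) hk (hc _)
      · exact (ih3 j (Finset.mem_sdiff.2 ⟨h1, h2⟩)).2
    have hlt : ∀ e ∈ s.out, D.index (k + 1) < e.2 := ih2.next_lt (by omega)
    have hS₁ : insert (D.pivot (k + 1)) s.S₁ = D.activeSet (k + 1) := by
      rw [ih1, AG1Data.activeSet_succ]
    have := whileLoop_isValid rule D (Fintype.card N) (k + 1)
      (fun j => P.switchingIndex (false, j)) (P.agScore D (k + 1))
      { s with S₁ := insert (D.pivot (k + 1)) s.S₁ }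
      ⟨ih2.subset.trans (Finset.subset_insert _ _), ih2.k₀_eq, ih2.nodup, ih2.mem_iff,
        ih2.snd_eq, ih2.pairwise,
        fun e he j hj => (hle j (hS₁ ▸ hj)).trans (hlt e he).le,
        fun hn e he => (hD.index_succ_le (by omega) (by omega)).trans_lt (hlt e he)⟩
      (by dsimp only; rw [hS₁, hD.card_activeSet hk])
      (fun j hj => by
        dsimp only at hj
        rw [hS₁] at hj
        rcases hD.agScore_eq_or (by omega) hk (Finset.mem_sdiff.1 hj).1 (hle j hj) with h | h
        · exact Or.inl h
        · exact Or.inr ⟨h.1.ne, h.2⟩)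
    dsimp only at this
    rw [hS₁] at this
    rw [run, forBody, ← hs, hS₁]
    exact this

end AG0

theorem theorem3 {N : Type*} [Fintype N] [DecidableEq N] [Nonempty N]
    (P : Project N) (D : AG1Data N) (hD : P.normalized.IsAG1Output D) (rule : ArgMaxRule N) :
    -- the output lists every state exactly once, with nonincreasing values,
    ((AG0.output rule P.β P.normalized.c D).map Prod.fst).Nodup ∧
    (∀ i : N, i ∈ (AG0.output rule P.β P.normalized.c D).map Prod.fst) ∧
    ((AG0.output rule P.β P.normalized.c D).map Prod.snd).Pairwise (· ≥ ·) ∧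
    -- and the values are the switching MPI and the AT switching index
    ∃ idx : Bool × N → ℝ, P.restless.IsMPI idx ∧
      ∀ e ∈ AG0.output rule P.β P.normalized.c D,
        e.2 = idx (false, e.1) ∧ P.normalized.IsATIndex false e.1 e.2 := by
  obtain ⟨-, hv, hrest⟩ := AG0.run_isValid rule (P := P.normalized) P.cost_nonneg hD le_rfl
  refine ⟨hv.nodup, fun i => ?_, hv.pairwise, P.normalized.switchingIndex,
    P.isMPI_switchingIndex, fun e he => ⟨hv.snd_eq e he, ?_⟩⟩
  · refine (hv.mem_iff i).2 ?_
    by_contra hi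
    -- After the last round a state not yet output would force `Fintype.card N ≠ Fintype.card N`.
    have huniv : D.activeSet (Fintype.card N) = Finset.univ :=
      Finset.eq_univ_of_card _ (hD.card_activeSet le_rfl)
    exact (hrest i (Finset.mem_sdiff.2 ⟨huniv ▸ Finset.mem_univ i, hi⟩)).1 rfl
  · rw [hv.snd_eq e he]
    exact P.normalized.isATIndex_switchingIndex (false, e.1)
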